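/- Let $1<p<\infty$ and let $X=\ell_p^2(\mathbb{C})$ be the space $\mathbb{C}^2$ with the norm $\|(z_1,z_2)\|=(|z_1|^p+|z_2|^p)^{1/p}$. Let $L(X)$ denote the space of bounded linear operators on $X$ with the operator norm. For $T,A\in L(X)$, write $T\perp_B A$ ($T$ is Birkhoff--James orthogonal to $A$) if $\|T+\lambda A\|\ge\|T\|$ for all $\lambda\in\mathbb{C}$. An operator $T\in L(X)$ is called left symmetric if, for every $A\in L(X)$, $T\perp_B A$ implies $A\perp_B T$. Then $T\in L(X)$ is left symmetric if and only if $T$ is the zero operator. -/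

import Mathlib

open scoped ENNReal

/-- `x` is Birkhoff–James orthogonal to `y` in a complex normed space:
`‖x + c • y‖ ≥ ‖x‖` for every complex scalar `c`. -/
def BJOrthogonal {E : Type*} [NormedAddCommGroup E] [NormedSpace ℂ E] (x y : E) : Prop :=
  ∀ c : ℂ, ‖x‖ ≤ ‖x + c • y‖

/-- `x` is left symmetric (for Birkhoff–James orthogonality) if `x ⊥ y` implies `y ⊥ x`
for all `y` in the space. -/
def IsLeftSymmetric {E : Type*} [NormedAddCommGroup E] [NormedSpace ℂ E] (x : E) : Prop :=
  ∀ y : E, BJOrthogonal x y → BJOrthogonal y x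

/-- The two-dimensional complex space `ℓ_p^2(ℂ)`, that is `ℂ²` with the `p`-norm. -/
abbrev EllTwo (p : ℝ≥0∞) : Type := PiLp p (fun _ : Fin 2 => ℂ)

/-! ### Norm attainment and orthogonality of operators -/

section General

variable {E F : Type*} [NormedAddCommGroup E] [NormedSpace ℂ E] [NormedAddCommGroup F]
  [NormedSpace ℂ F]

/-! Let `T ≠ 0` be left symmetric with norming vector `x`. Every `A` with `T x ⊥ A x` satisfies `T ⊥
A`, hence `A ⊥ T`, and by `BJOrthogonal.exists_norming` some norming vector of `A` admits no
norm-decreasing step along `-T`.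

Testing with rank one `A` shows that `T` kills some `y` mutually orthogonal to `x`
(`EllTwo.exists_kernel`), so `T` has rank one, and that `T x` is mutually orthogonal to some `w`
(`EllTwo.exists_range`). Mutual orthogonality is rigid in `ℓ_p^2`: up to an isometry such a pair is
the axes or the diagonals (`EllTwo.exists_mapsLines`). Thus, up to isometries and a scalar, `T` is
one of four explicit matrices `M`. For each of them a nonnegative matrix `A`, sending the direction
of `x` to that of `w`, violates `A ⊥ M`. -/

/-- On a nontrivial finite-dimensional space every operator attains its norm. -/
theorem exists_norm_one_norm_apply_eq [FiniteDimensional ℂ E] [Nontrivial E] (B : E →L[ℂ] F) :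
    ∃ v : E, ‖v‖ = 1 ∧ ‖B v‖ = ‖B‖ := by
  have : ProperSpace E := FiniteDimensional.proper ℂ E
  obtain ⟨w, hw⟩ := exists_norm_eq E (zero_le_one (α := ℝ))
  obtain ⟨v, hv, hmax⟩ := (isCompact_sphere (0 : E) 1).exists_isMaxOn
    ⟨w, by simpa using hw⟩ (f := fun z => ‖B z‖) (by fun_prop)
  have hv1 : ‖v‖ = 1 := by simpa using hv
  refine ⟨v, hv1, le_antisymm (by simpa [hv1] using B.le_opNorm v) ?_⟩
  refine B.opNorm_le_bound (norm_nonneg _) fun z => ?_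
  rcases eq_or_ne z 0 with rfl | hz
  · simp
  have hz' : ‖z‖ ≠ 0 := norm_ne_zero_iff.mpr hz
  have h := hmax (a := ((‖z‖⁻¹ : ℝ) : ℂ) • z) (by
    simp [norm_smul, hz'])
  simp only [Set.mem_ofPred_eq, map_smul, norm_smul, Complex.norm_real, norm_inv, norm_norm] at h
  rwa [inv_mul_le_iff₀ (by positivity), mul_comm] at h

/-- Convexity of `s ↦ ‖x - s • y‖`: once it has returned to its value at `0`, it stays at least that
large. -/
theorem norm_le_norm_sub_smul_of_le {x y : E} {t s : ℝ} (ht : 0 < t) (hts : t ≤ s)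
    (h : ‖x‖ ≤ ‖x - (t : ℂ) • y‖) : ‖x‖ ≤ ‖x - (s : ℂ) • y‖ := by
  have hs : 0 < s := ht.trans_le hts
  have hsC : (s : ℂ) ≠ 0 := by exact_mod_cast hs.ne'
  have e : x - (t : ℂ) • y
      = ((1 - t / s : ℝ) : ℂ) • x + ((t / s : ℝ) : ℂ) • (x - (s : ℂ) • y) := by
    push_cast
    rw [smul_sub, smul_smul, div_mul_cancel₀ _ hsC, sub_smul, one_smul]
    abel
  have h1 : 0 ≤ 1 - t / s := by
    rw [sub_nonneg, div_le_one hs]; exact hts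
  have h2 : 0 < t / s := by positivity
  have h3 := norm_add_le (((1 - t / s : ℝ) : ℂ) • x) (((t / s : ℝ) : ℂ) • (x - (s : ℂ) • y))
  rw [← e, norm_smul, norm_smul, Complex.norm_real, Complex.norm_real, Real.norm_of_nonneg h1,
    Real.norm_of_nonneg h2.le] at h3
  have h4 : t / s * ‖x‖ ≤ t / s * ‖x - (s : ℂ) • y‖ := by linarith
  exact le_of_mul_le_mul_left h4 h2

/-- If `A` is Birkhoff–James orthogonal to `T`, then moving in the direction `-T` does not
decrease the norm at some vector at which `A` attains its norm. -/
theorem BJOrthogonal.exists_norming [FiniteDimensional ℂ E] [Nontrivial E] {A T : E →L[ℂ] F}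
    (h : BJOrthogonal A T) :
    ∃ v : E, ‖v‖ = 1 ∧ ‖A v‖ = ‖A‖ ∧ ∀ s : ℝ, 0 ≤ s → ‖A v‖ ≤ ‖A v - (s : ℂ) • T v‖ := by
  have : ProperSpace E := FiniteDimensional.proper ℂ E
  -- The required vector is a limit of norming vectors of `A - t n • T` as `t n → 0`.
  set t : ℕ → ℝ := fun n => 1 / ((n : ℝ) + 1) with ht
  have htpos : ∀ n, 0 < t n := fun n => Nat.one_div_pos_of_nat
  have htlim : Filter.Tendsto t Filter.atTop (nhds 0) := tendsto_one_div_add_atTop_nhds_zero_nat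
  choose v hv1 hv2 using fun n => exists_norm_one_norm_apply_eq (A - (t n : ℂ) • T)
  obtain ⟨w, hw, φ, hφ, hlim⟩ := (isCompact_sphere (0 : E) 1).tendsto_subseq
    (x := v) (fun n => by simpa using hv1 n)
  have hw1 : ‖w‖ = 1 := by simpa using hw
  have hA : ∀ n, ‖A‖ ≤ ‖A (v n) - (t n : ℂ) • T (v n)‖ := fun n => by
    have h1 := h (-(t n : ℂ))
    rw [neg_smul, ← sub_eq_add_neg, ← hv2 n] at h1
    simpa using h1
  have hle : ∀ n, ‖A (v n)‖ ≤ ‖A‖ := fun n => by simpa [hv1 n] using A.le_opNorm (v n)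
  have htlim' := htlim.comp hφ.tendsto_atTop
  have hAlim : Filter.Tendsto (fun n => A (v (φ n))) Filter.atTop (nhds (A w)) :=
    (A.continuous.tendsto w).comp hlim
  have hTlim : Filter.Tendsto (fun n => T (v (φ n))) Filter.atTop (nhds (T w)) :=
    (T.continuous.tendsto w).comp hlim
  have htC : Filter.Tendsto (fun n => ((t (φ n) : ℝ) : ℂ)) Filter.atTop (nhds ((0 : ℝ) : ℂ)) :=
    (Complex.continuous_ofReal.tendsto 0).comp htlim'
  refine ⟨w, hw1, le_antisymm (by simpa [hw1] using A.le_opNorm w) ?_, fun s hs => ?_⟩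
  · have h1 := (hAlim.sub (htC.smul hTlim)).norm
    simp only [Complex.ofReal_zero, zero_smul, sub_zero] at h1
    exact ge_of_tendsto' h1 fun n => hA (φ n)
  · rcases hs.eq_or_lt with rfl | hs
    · simp
    refine le_of_tendsto_of_tendsto hAlim.norm (hAlim.sub (hTlim.const_smul (s : ℂ))).norm ?_
    filter_upwards [htlim'.eventually (gt_mem_nhds hs)] with n hn
    exact norm_le_norm_sub_smul_of_le (htpos (φ n)) hn.le ((hle _).trans (hA _))

theorem BJOrthogonal.smul_right {x y : E} (h : BJOrthogonal x y) (c : ℂ) :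
    BJOrthogonal x (c • y) := fun d => by
  rw [smul_smul]; exact h _

/-- Orthogonality of the images at a vector where `T` attains its norm implies orthogonality. -/
theorem BJOrthogonal.of_norming {T A : E →L[ℂ] F} {x : E} (hx : x ≠ 0)
    (hT : ‖T x‖ = ‖T‖ * ‖x‖) (h : BJOrthogonal (T x) (A x)) : BJOrthogonal T A := fun c => by
  have h1 := (h c).trans ((T + c • A).le_opNorm x)
  rw [hT] at h1
  exact le_of_mul_le_mul_right h1 (norm_pos_iff.mpr hx)

end General

/-! ### Coordinates and matrices on `ℓ_p^2` -/

section EllTwo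

variable {p : ℝ≥0∞}

/-- The vector with the given coordinates. -/
def EllTwo.mk (p : ℝ≥0∞) (a b : ℂ) : EllTwo p := WithLp.toLp p ![a, b]

@[simp] theorem EllTwo.mk_zero (a b : ℂ) : EllTwo.mk p a b 0 = a := rfl

@[simp] theorem EllTwo.mk_one (a b : ℂ) : EllTwo.mk p a b 1 = b := rfl

theorem EllTwo.ext {x y : EllTwo p} (h0 : x 0 = y 0) (h1 : x 1 = y 1) : x = y := by
  refine PiLp.ext fun i => ?_
  fin_cases i <;> assumption

theorem one_lt_toReal (hp_one : 1 < p) (hp_top : p < ∞) : 1 < p.toReal := by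
  rw [← ENNReal.toReal_one]
  exact (ENNReal.toReal_lt_toReal ENNReal.one_ne_top hp_top.ne).mpr hp_one

theorem EllTwo.norm_rpow (hp : 1 < p.toReal) (x : EllTwo p) :
    ‖x‖ ^ p.toReal = ‖x 0‖ ^ p.toReal + ‖x 1‖ ^ p.toReal := by
  rw [PiLp.norm_eq_sum (by linarith), Fin.sum_univ_two, ← Real.rpow_mul (by positivity),
    one_div_mul_cancel (by linarith), Real.rpow_one]

theorem EllTwo.span_axes (z : EllTwo p) :
    ∃ s t : ℂ, z = s • EllTwo.mk p 1 0 + t • EllTwo.mk p 0 1 :=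
  ⟨z 0, z 1, EllTwo.ext (by simp) (by simp)⟩

theorem EllTwo.span_diagonals {σ : ℂ} (hσ : σ * σ = 1) (z : EllTwo p) :
    ∃ s t : ℂ, z = s • EllTwo.mk p 1 σ + t • EllTwo.mk p 1 (-σ) := by
  refine ⟨(z 0 + σ * z 1) / 2, (z 0 - σ * z 1) / 2, EllTwo.ext (by simp; ring) ?_⟩
  simp
  linear_combination -z 1 * hσ

variable [Fact (1 ≤ p)]

theorem EllTwo.norm_le_norm_iff (hp : 1 < p.toReal) (x y : EllTwo p) :
    ‖x‖ ≤ ‖y‖ ↔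
      ‖x 0‖ ^ p.toReal + ‖x 1‖ ^ p.toReal ≤ ‖y 0‖ ^ p.toReal + ‖y 1‖ ^ p.toReal := by
  rw [← EllTwo.norm_rpow hp, ← EllTwo.norm_rpow hp,
    Real.rpow_le_rpow_iff (norm_nonneg _) (norm_nonneg _) (by linarith)]

/-- The operator on `ℓ_p^2` with matrix `!![a, b; c, d]`. -/
noncomputable def EllTwo.matrix (p : ℝ≥0∞) [Fact (1 ≤ p)] (a b c d : ℂ) : EllTwo p →L[ℂ] EllTwo p :=
  LinearMap.toContinuousLinearMap
    { toFun := fun z => EllTwo.mk p (a * z 0 + b * z 1) (c * z 0 + d * z 1)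
      map_add' := fun x y => EllTwo.ext (by simp; ring) (by simp; ring)
      map_smul' := fun r x => EllTwo.ext (by simp; ring) (by simp; ring) }

@[simp] theorem EllTwo.matrix_apply (a b c d : ℂ) (z : EllTwo p) :
    EllTwo.matrix p a b c d z = EllTwo.mk p (a * z 0 + b * z 1) (c * z 0 + d * z 1) := rfl

/-! ### Strict convexity -/

theorem midpoint_rpow_lt {q a b : ℝ} (hq : 1 < q) (ha : 0 ≤ a) (hb : 0 ≤ b) (hab : a ≠ b) :
    2 * ((a + b) / 2) ^ q < a ^ q + b ^ q := by
  have h := (strictConvexOn_rpow hq).2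
  have h := h ha hb hab (show (0 : ℝ) < 1 / 2 by norm_num) (show (0 : ℝ) < 1 / 2 by norm_num)
    (by norm_num)
  simp only [smul_eq_mul] at h
  rw [show (a + b) / 2 = 1 / 2 * a + 1 / 2 * b by ring]
  linarith

theorem midpoint_rpow_le {q a b : ℝ} (hq : 1 < q) (ha : 0 ≤ a) (hb : 0 ≤ b) :
    2 * ((a + b) / 2) ^ q ≤ a ^ q + b ^ q := by
  rcases eq_or_ne a b with rfl | hab
  · rw [add_self_div_two, two_mul]
  · exact (midpoint_rpow_lt hq ha hb hab).le

/-- If the moduli differ, strictness comes from the power function; if they agree, it comes from the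
triangle inequality in `ℂ`. -/
theorem norm_midpoint_rpow_lt {q : ℝ} (hq : 1 < q) {a b : ℂ} (hab : a ≠ b) :
    2 * (‖a + b‖ / 2) ^ q < ‖a‖ ^ q + ‖b‖ ^ q := by
  have hq0 : 0 < q := by linarith
  rcases eq_or_ne ‖a‖ ‖b‖ with h | h
  · have hlt : ‖a + b‖ < ‖a‖ + ‖b‖ :=
      (norm_add_le a b).lt_of_ne fun h' => hab (eq_of_norm_eq_of_norm_add_eq h h')
    have : (‖a + b‖ / 2) ^ q < ‖b‖ ^ q :=
      Real.rpow_lt_rpow (by positivity) (by linarith) hq0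
    rw [h]; linarith
  · refine lt_of_le_of_lt ?_ (midpoint_rpow_lt hq (norm_nonneg _) (norm_nonneg _) h)
    gcongr
    exact norm_add_le a b

theorem norm_midpoint_rpow_le {q : ℝ} (hq : 1 < q) (a b : ℂ) :
    2 * (‖a + b‖ / 2) ^ q ≤ ‖a‖ ^ q + ‖b‖ ^ q := by
  rcases eq_or_ne a b with rfl | hab
  · rw [← two_mul, norm_mul, Complex.norm_ofNat, mul_div_cancel_left₀ _ two_ne_zero, two_mul]
  · exact (norm_midpoint_rpow_lt hq hab).le

/-- Strict convexity of the unit ball, from the midpoint inequality in each coordinate. -/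
theorem EllTwo.eq_of_norm_add {p : ℝ≥0∞} [Fact (1 ≤ p)] (hp : 1 < p.toReal) {x y : EllTwo p}
    (hx : ‖x‖ = 1) (hy : ‖y‖ = 1) (h : 2 ≤ ‖x + y‖) : x = y := by
  by_contra hne
  have hq0 : 0 < p.toReal := by linarith
  have e1 := EllTwo.norm_rpow hp x
  have e2 := EllTwo.norm_rpow hp y
  have e3 := EllTwo.norm_rpow hp ((1 / 2 : ℂ) • (x + y))
  have e4 : 1 ≤ ‖(1 / 2 : ℂ) • (x + y)‖ := by
    rw [norm_smul]; norm_num; linarith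
  have e5 := Real.one_le_rpow e4 hq0.le
  rw [e3] at e5
  rw [hx, Real.one_rpow] at e1
  rw [hy, Real.one_rpow] at e2
  have hc : ∀ i, ‖((1 / 2 : ℂ) • (x + y)) i‖ = ‖x i + y i‖ / 2 := fun i => by
    rw [PiLp.smul_apply, PiLp.add_apply, norm_smul]; norm_num; ring
  rw [hc, hc] at e5
  have i0 := norm_midpoint_rpow_le hp (x 0) (y 0)
  have i1 := norm_midpoint_rpow_le hp (x 1) (y 1)
  rcases eq_or_ne (x 0) (y 0) with h0 | h0
  · rcases eq_or_ne (x 1) (y 1) with h1 | h1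
    · exact hne (EllTwo.ext h0 h1)
    · have := norm_midpoint_rpow_lt hp h1; linarith
  · have := norm_midpoint_rpow_lt hp h0; linarith

/-! ### Mutually orthogonal directions -/

/-- Birkhoff–James orthogonality in `ℓ_p^2` implies that the semi-inner product vanishes. -/
theorem EllTwo.semiInner_eq_zero (hp : 1 < p.toReal) {x y : EllTwo p} (h : BJOrthogonal x y) :
    ((‖x 0‖ ^ (p.toReal - 2) : ℝ) : ℂ) * (starRingEnd ℂ (x 0) * y 0)
      + ((‖x 1‖ ^ (p.toReal - 2) : ℝ) : ℂ) * (starRingEnd ℂ (x 1) * y 1) = 0 := by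
  set q := p.toReal with hq
  set G : ℂ := ((‖x 0‖ ^ (q - 2) : ℝ) : ℂ) * (starRingEnd ℂ (x 0) * y 0)
      + ((‖x 1‖ ^ (q - 2) : ℝ) : ℂ) * (starRingEnd ℂ (x 1) * y 1) with hG
  -- With this phase, the derivative of `‖x + t • μ • y‖ ^ q` at `t = 0` is `q * ‖G‖ ^ 2`; it
  -- vanishes because `0` is a minimum.
  set μ : ℂ := starRingEnd ℂ G with hμ
  have hd : ∀ i, HasDerivAt (fun t : ℝ => ‖x i + (t : ℂ) * (μ * y i)‖ ^ q)
      (q * ‖x i‖ ^ (q - 2) * (starRingEnd ℂ (x i) * (μ * y i)).re) 0 := fun i => by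
    have h1 : HasDerivAt (fun t : ℝ => x i + (t : ℂ) * (μ * y i)) (μ * y i) 0 := by
      simpa using ((Complex.ofRealCLM.hasDerivAt (x := 0)).mul_const (μ * y i)).const_add (x i)
    have h2 := hasFDerivAt_norm_rpow (x i + ((0 : ℝ) : ℂ) * (μ * y i)) hp
    have h3 := h2.comp_hasDerivAt (0 : ℝ) h1
    simp only [Complex.ofReal_zero, zero_mul, add_zero] at h3
    refine h3.congr_deriv ?_
    rw [smul_apply, innerSL_apply_apply, Complex.inner, smul_eq_mul, mul_comm (μ * y i)]
  have hsum := (hd 0).add (hd 1)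
  have hmin : IsLocalMin ((fun t : ℝ => ‖x 0 + (t : ℂ) * (μ * y 0)‖ ^ q)
      + fun t : ℝ => ‖x 1 + (t : ℂ) * (μ * y 1)‖ ^ q) 0 := by
    refine Filter.Eventually.of_forall fun t => ?_
    have h1 := (EllTwo.norm_le_norm_iff hp _ _).mp (h ((t : ℂ) * μ))
    simpa [mul_assoc] using h1
  have h0 := hmin.hasDerivAt_eq_zero hsum
  have hre : (μ * G).re = 0 := by
    have e : (μ * G).re = ‖x 0‖ ^ (q - 2) * (starRingEnd ℂ (x 0) * (μ * y 0)).re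
        + ‖x 1‖ ^ (q - 2) * (starRingEnd ℂ (x 1) * (μ * y 1)).re := by
      rw [← Complex.re_ofReal_mul, ← Complex.re_ofReal_mul (‖x 1‖ ^ (q - 2)), ← Complex.add_re, hG]
      congr 1
      ring
    have hmul : q * (μ * G).re = 0 := by rw [e]; linear_combination h0
    exact (mul_eq_zero.mp hmul).resolve_left (by linarith)
  rw [hμ, mul_comm, Complex.mul_conj, Complex.ofReal_re] at hre
  exact Complex.normSq_eq_zero.mp hre

theorem EllTwo.exists_isometry (hp : 1 < p.toReal) {f g : EllTwo p}
    (h : ∀ a b : ℂ, ‖a • f + b • g‖ ^ p.toReal = ‖a‖ ^ p.toReal + ‖b‖ ^ p.toReal) :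
    ∃ V : EllTwo p ≃ₗᵢ[ℂ] EllTwo p, ∀ z, V z = z 0 • f + z 1 • g := by
  let V : EllTwo p →ₗᵢ[ℂ] EllTwo p :=
    { toFun := fun z => z 0 • f + z 1 • g
      map_add' := fun x y => by simp only [PiLp.add_apply]; module
      map_smul' := fun r x => by
        simp only [PiLp.smul_apply, smul_eq_mul, RingHom.id_apply]; module
      norm_map' := fun z => by
        have h1 := h (z 0) (z 1)
        rw [← EllTwo.norm_rpow hp] at h1
        exact (Real.rpow_left_inj (norm_nonneg _) (norm_nonneg _) (by linarith)).mp h1 }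
  exact ⟨V.toLinearIsometryEquiv rfl, fun z => rfl⟩

/-- `V` maps the pair of lines through `e` and `e'` to the lines through `x` and `y`. -/
def MapsLines (V : EllTwo p ≃ₗᵢ[ℂ] EllTwo p) (e e' x y : EllTwo p) : Prop :=
  (∃ a : ℂ, a ≠ 0 ∧ x = a • V e) ∧ ∃ b : ℂ, V e' = b • y

/-- In logarithms this is a homogeneous linear system for `log a - log b` and `log c - log d`, with
determinant `(q - 1) ^ 2 - 1 = q * (q - 2)`. -/
theorem eq_or_eq_two_of_rpow_mul {q a b c d : ℝ} (ha : 0 < a) (hb : 0 < b) (hc : 0 < c)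
    (hd : 0 < d) (hq : 1 < q) (h1 : a ^ (q - 1) * c = b ^ (q - 1) * d)
    (h2 : c ^ (q - 1) * a = d ^ (q - 1) * b) : a = b ∨ q = 2 := by
  have l1 := congrArg Real.log h1
  have l2 := congrArg Real.log h2
  rw [Real.log_mul (by positivity) (by positivity), Real.log_mul (by positivity) (by positivity),
    Real.log_rpow (by positivity), Real.log_rpow (by positivity)] at l1 l2
  have h3 : (Real.log a - Real.log b) * ((q - 2) * q) = 0 := by linear_combination (q - 1) * l1 - l2
  rcases mul_eq_zero.mp h3 with h | h
  · exact .inl (Real.log_injOn_pos ha hb (by linarith))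
  · right
    rcases mul_eq_zero.mp h with h | h <;> linarith

theorem norm_eq_of_semiInner {q : ℝ} {x0 x1 y0 y1 : ℂ} (h0 : x0 ≠ 0) (h1 : x1 ≠ 0)
    (h : ((‖x0‖ ^ (q - 2) : ℝ) : ℂ) * (starRingEnd ℂ x0 * y0)
      + ((‖x1‖ ^ (q - 2) : ℝ) : ℂ) * (starRingEnd ℂ x1 * y1) = 0) :
    ‖x0‖ ^ (q - 1) * ‖y0‖ = ‖x1‖ ^ (q - 1) * ‖y1‖ := by
  have h2 := congrArg norm (eq_neg_of_add_eq_zero_left h)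
  rw [norm_neg, norm_mul, norm_mul, norm_mul, norm_mul, Complex.norm_real, Complex.norm_real,
    Real.norm_of_nonneg (by positivity), Real.norm_of_nonneg (by positivity), RCLike.norm_conj,
    RCLike.norm_conj, ← mul_assoc, ← mul_assoc, ← Real.rpow_add_one (norm_ne_zero_iff.mpr h0),
    ← Real.rpow_add_one (norm_ne_zero_iff.mpr h1)] at h2
  rwa [show q - 1 = q - 2 + 1 by ring]

/-- Up to an isometry, a pair of mutually orthogonal directions of `ℓ_p^2` is either the pair of
coordinate axes or the pair of diagonals. -/
theorem EllTwo.exists_mapsLines (hp : 1 < p.toReal) {x y : EllTwo p} (hx : x ≠ 0) (hy : y ≠ 0)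
    (hxy : BJOrthogonal x y) (hyx : BJOrthogonal y x) :
    (∃ V, MapsLines V (EllTwo.mk p 1 0) (EllTwo.mk p 0 1) x y) ∨
      ∀ σ : ℂ, σ = 1 ∨ σ = -1 → ∃ V, MapsLines V (EllTwo.mk p 1 σ) (EllTwo.mk p 1 (-σ)) x y := by
  have hq0 : p.toReal ≠ 0 := by linarith
  have g1 := EllTwo.semiInner_eq_zero hp hxy
  have g2 := EllTwo.semiInner_eq_zero hp hyx
  have hpow : ∀ z : ℂ, z ≠ 0 → ((‖z‖ ^ (p.toReal - 2) : ℝ) : ℂ) ≠ 0 := fun z hz => by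
    have := norm_pos_iff.mpr hz
    exact_mod_cast (by positivity : ‖z‖ ^ (p.toReal - 2) ≠ 0)
  have hconj : ∀ z : ℂ, z ≠ 0 → starRingEnd ℂ z ≠ 0 := fun z hz => by simpa using hz
  by_cases h1 : x 1 = 0
  · have h0 : x 0 ≠ 0 := fun h0 => hx (EllTwo.ext (by simpa using h0) (by simpa using h1))
    have k0 : y 0 = 0 := by simpa [h1, hpow _ h0, h0] using g1
    have k1 : y 1 ≠ 0 := fun k1 => hy (EllTwo.ext (by simpa using k0) (by simpa using k1))
    obtain ⟨V, hV⟩ := EllTwo.exists_isometry hp (f := EllTwo.mk p 1 0) (g := EllTwo.mk p 0 1)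
      fun a b => by simp [EllTwo.norm_rpow hp]
    refine .inl ⟨V, ⟨x 0, h0, ?_⟩, (y 1)⁻¹, ?_⟩
    · apply EllTwo.ext <;> simp [hV, h1]
    · apply EllTwo.ext <;> simp [hV, k0, k1]
  by_cases h0 : x 0 = 0
  · have k1 : y 1 = 0 := by simpa [h0, hpow _ h1, h1] using g1
    have k0 : y 0 ≠ 0 := fun k0 => hy (EllTwo.ext (by simpa using k0) (by simpa using k1))
    obtain ⟨V, hV⟩ := EllTwo.exists_isometry hp (f := EllTwo.mk p 0 1) (g := EllTwo.mk p 1 0)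
      fun a b => by simp [EllTwo.norm_rpow hp, add_comm]
    refine .inl ⟨V, ⟨x 1, h1, ?_⟩, (y 0)⁻¹, ?_⟩
    · apply EllTwo.ext <;> simp [hV, h0]
    · apply EllTwo.ext <;> simp [hV, k0, k1]
  have c0 := hconj _ h0
  have c1 := hconj _ h1
  have k0 : y 0 ≠ 0 := fun k0 => by
    have k1 : y 1 = 0 := by simpa [k0, hpow _ h1, h1] using g1
    exact hy (EllTwo.ext (by simpa using k0) (by simpa using k1))
  have k1 : y 1 ≠ 0 := fun k1 => by
    have k0 : y 0 = 0 := by simpa [k1, hpow _ h0, h0] using g1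
    exact hy (EllTwo.ext (by simpa using k0) (by simpa using k1))
  rcases eq_or_eq_two_of_rpow_mul (norm_pos_iff.mpr h0) (norm_pos_iff.mpr h1)
    (norm_pos_iff.mpr k0) (norm_pos_iff.mpr k1) hp (norm_eq_of_semiInner h0 h1 g1)
    (norm_eq_of_semiInner k0 k1 g2) with hab | h2
  -- Equal moduli: a diagonal matrix of phases takes the line of `(1, σ)` to that of `x`.
  · right
    intro σ hσ
    have hσ2 : σ * σ = 1 := by rcases hσ with rfl | rfl <;> norm_num
    have hσn : ‖σ‖ = 1 := by rcases hσ with rfl | rfl <;> simp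
    rw [hab, ← mul_add] at g1
    have g3 := (mul_eq_zero.mp g1).resolve_left (hpow _ h1)
    have ha : ‖x 0‖ ≠ 0 := norm_ne_zero_iff.mpr h0
    have hb : ‖x 1‖ ≠ 0 := norm_ne_zero_iff.mpr h1
    have haC : (‖x 0‖ : ℂ) ≠ 0 := by exact_mod_cast ha
    have hsq0 : starRingEnd ℂ (x 0) * x 0 = (‖x 0‖ : ℂ) ^ 2 := Complex.conj_mul' _
    have hsq1 : starRingEnd ℂ (x 1) * x 1 = (‖x 0‖ : ℂ) ^ 2 := by
      rw [hab]; exact Complex.conj_mul' _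
    obtain ⟨V, hV⟩ := EllTwo.exists_isometry hp (f := EllTwo.mk p (x 0 / ‖x 0‖) 0)
      (g := EllTwo.mk p 0 (σ * x 1 / ‖x 0‖)) fun a b => by
        rw [EllTwo.norm_rpow hp]
        simp [hab, hb, hσn]
    refine ⟨V, ⟨‖x 0‖, haC, ?_⟩, -‖x 0‖ / (y 1 * starRingEnd ℂ (x 1)), ?_⟩
    · apply EllTwo.ext
      · simp [hV]; field_simp
      · simp [hV]; field_simp; linear_combination -hσ2
    · generalize (‖x 0‖ : ℂ) = n at *
      apply EllTwo.ext
      · simp [hV]; field_simp; linear_combination x 0 * g3 - y 0 * hsq0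
      · simp [hV]; field_simp; linear_combination -σ * σ * hsq1 - n ^ 2 * hσ2
  -- Hilbert space case: the unitary whose first column is `x / ‖x‖` works.
  · left
    have hpow1 : ∀ z : ℂ, z ≠ 0 → ((‖z‖ ^ (p.toReal - 2) : ℝ) : ℂ) = 1 := fun z hz => by
      rw [h2, sub_self, Real.rpow_zero, Complex.ofReal_one]
    rw [hpow1 _ h0, hpow1 _ h1, one_mul, one_mul] at g1
    have hpos : 0 < ‖x 0‖ ^ 2 + ‖x 1‖ ^ 2 := by
      have := norm_pos_iff.mpr h0
      positivity
    obtain ⟨n, hn, hnsq⟩ : ∃ n : ℝ, 0 < n ∧ n ^ 2 = ‖x 0‖ ^ 2 + ‖x 1‖ ^ 2 :=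
      ⟨√(‖x 0‖ ^ 2 + ‖x 1‖ ^ 2), Real.sqrt_pos.mpr hpos, Real.sq_sqrt hpos.le⟩
    have hnC : (n : ℂ) ≠ 0 := by exact_mod_cast hn.ne'
    have hnsqC : (n : ℂ) ^ 2 = x 0 * starRingEnd ℂ (x 0) + x 1 * starRingEnd ℂ (x 1) := by
      rw [Complex.mul_conj', Complex.mul_conj']
      have h3 := congrArg Complex.ofReal hnsq
      push_cast at h3
      exact h3
    obtain ⟨V, hV⟩ := EllTwo.exists_isometry hp (f := EllTwo.mk p (x 0 / n) (x 1 / n))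
      (g := EllTwo.mk p (-starRingEnd ℂ (x 1) / n) (starRingEnd ℂ (x 0) / n)) fun a b => by
        rw [EllTwo.norm_rpow hp, h2]
        simp only [Real.rpow_ofNat]
        apply Complex.ofReal_injective
        push_cast
        simp only [← Complex.mul_conj']
        simp
        field_simp
        linear_combination (-(a * starRingEnd ℂ a) - b * starRingEnd ℂ b) * hnsqC
    refine ⟨V, ⟨n, hnC, ?_⟩, starRingEnd ℂ (x 0) / (n * y 1), ?_⟩
    · apply EllTwo.ext <;> simp [hV] <;> field_simp
    · apply EllTwo.ext
      · simp [hV]; field_simp; linear_combination -g1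
      · simp [hV]; field_simp

/-! ### Kernel and range of a left symmetric operator -/

/-- If `x` norms a left symmetric operator `T` and `T x ⊥ A x`, then `A ⊥ T`. -/
theorem IsLeftSymmetric.of_norming {E F : Type*} [NormedAddCommGroup E] [NormedSpace ℂ E]
    [NormedAddCommGroup F] [NormedSpace ℂ F] {T : E →L[ℂ] F} (hT : IsLeftSymmetric T) {x : E}
    (hx : x ≠ 0) (hTx : ‖T x‖ = ‖T‖ * ‖x‖) {A : E →L[ℂ] F} (h : BJOrthogonal (T x) (A x)) :
    BJOrthogonal A T :=
  hT A (h.of_norming hx hTx)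

/-- The functional `z ↦ z 0 * x 1 - z 1 * x 0`. -/
noncomputable def EllTwo.area (x : EllTwo p) : EllTwo p →L[ℂ] ℂ :=
  LinearMap.toContinuousLinearMap
    { toFun := fun z => z 0 * x 1 - z 1 * x 0
      map_add' := fun y z => by simp; ring
      map_smul' := fun r y => by simp; ring }

theorem EllTwo.area_apply (x z : EllTwo p) : EllTwo.area x z = z 0 * x 1 - z 1 * x 0 := rfl

theorem EllTwo.area_self (x : EllTwo p) : EllTwo.area x x = 0 := by
  rw [EllTwo.area_apply]; ring

theorem EllTwo.area_ne_zero {x : EllTwo p} (hx : x ≠ 0) : EllTwo.area x ≠ 0 := fun h => hx <| by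
  have h0 := DFunLike.congr_fun h (EllTwo.mk p 1 0)
  have h1 := DFunLike.congr_fun h (EllTwo.mk p 0 1)
  simp only [EllTwo.area_apply] at h0 h1
  exact EllTwo.ext (by simpa using h1) (by simpa using h0)

theorem BJOrthogonal.zero_right {E : Type*} [NormedAddCommGroup E] [NormedSpace ℂ E] (x : E) :
    BJOrthogonal x 0 := fun c => by simp

/-- Two vectors at which a functional attains its norm agree up to a phase. -/
theorem EllTwo.eq_smul_of_norming (hp : 1 < p.toReal) {h : EllTwo p →L[ℂ] ℂ} (hh : h ≠ 0)
    {y z : EllTwo p} (hy : ‖y‖ = 1) (hz : ‖z‖ = 1) (hhy : ‖h y‖ = ‖h‖) (hhz : ‖h z‖ = ‖h‖) :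
    z = (h z / h y) • y := by
  have hpos : 0 < ‖h‖ := norm_pos_iff.mpr hh
  have hy0 : h y ≠ 0 := norm_pos_iff.mp (hhy ▸ hpos)
  have hc : ‖h z / h y‖ = 1 := by rw [norm_div, hhy, hhz, div_self hpos.ne']
  refine EllTwo.eq_of_norm_add hp hz (by rw [norm_smul, hc, hy, one_mul]) ?_
  have h1 := h.le_opNorm (z + (h z / h y) • y)
  rw [map_add, map_smul, smul_eq_mul, div_mul_cancel₀ _ hy0, ← two_mul, norm_mul, hhz,
    Complex.norm_ofNat, mul_comm] at h1
  exact le_of_mul_le_mul_left h1 hpos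

instance : Nontrivial (EllTwo p) :=
  ⟨⟨0, EllTwo.mk p 1 0, fun h => by simpa using congrArg (fun z : EllTwo p => z 0) h⟩⟩

/-- A left symmetric operator normed by `x` kills some `y` with `x ⊥ y` and `y ⊥ x`. -/
theorem EllTwo.exists_kernel (hp : 1 < p.toReal) {T : EllTwo p →L[ℂ] EllTwo p} (hT0 : T ≠ 0)
    (hT : IsLeftSymmetric T) {x : EllTwo p} (hx : x ≠ 0) (hTx : ‖T x‖ = ‖T‖ * ‖x‖) :
    ∃ y : EllTwo p, y ≠ 0 ∧ T y = 0 ∧ BJOrthogonal x y ∧ BJOrthogonal y x := by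
  set h := EllTwo.area x with hdef
  have hh : h ≠ 0 := EllTwo.area_ne_zero hx
  have hpos : 0 < ‖h‖ := norm_pos_iff.mpr hh
  obtain ⟨y, hy1, hhy⟩ := exists_norm_one_norm_apply_eq h
  have hy0 : h y ≠ 0 := norm_pos_iff.mp (hhy ▸ hpos)
  have hTy : T y = 0 := by
    by_contra hne
    -- This operator kills `x`, agrees with `T` at `y`, and is normed only by multiples of `y`. A
    -- step of length `1` along `-T` there reaches `0`.
    have hA : BJOrthogonal (ContinuousLinearMap.smulRight h ((h y)⁻¹ • T y)) T :=
      hT.of_norming hx hTx (by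
        rw [ContinuousLinearMap.smulRight_apply, hdef, EllTwo.area_self, zero_smul]
        exact BJOrthogonal.zero_right _)
    obtain ⟨z, hz1, hz2, hz3⟩ := hA.exists_norming
    have hne' : (h y)⁻¹ • T y ≠ 0 := smul_ne_zero (inv_ne_zero hy0) hne
    rw [ContinuousLinearMap.norm_smulRight_apply, ContinuousLinearMap.smulRight_apply,
      norm_smul] at hz2
    have hhz := mul_right_cancel₀ (norm_ne_zero_iff.mpr hne') hz2
    have hz := EllTwo.eq_smul_of_norming hp hh hy1 hz1 hhy hhz
    have h3 := hz3 1 zero_le_one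
    have e : T z = h z • (h y)⁻¹ • T y := by
      conv_lhs => rw [hz]
      rw [map_smul, smul_smul, div_eq_mul_inv]
    rw [ContinuousLinearMap.smulRight_apply, e, Complex.ofReal_one, one_smul, sub_self, norm_zero,
      norm_le_zero_iff] at h3
    refine smul_ne_zero ?_ hne' h3
    exact norm_pos_iff.mp (hhz ▸ hpos)
  refine ⟨y, fun h0 => by simp [h0] at hy1, hTy, fun c => ?_, fun c => ?_⟩
  · have h1 := T.le_opNorm (x + c • y)
    rw [map_add, map_smul, hTy, smul_zero, add_zero, hTx] at h1
    exact le_of_mul_le_mul_left h1 (norm_pos_iff.mpr hT0)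
  · have h1 := h.le_opNorm (y + c • x)
    rw [map_add, map_smul, hdef, EllTwo.area_self, smul_zero, add_zero, ← hdef, hhy] at h1
    rw [hy1]
    exact le_of_mul_le_mul_left (by simpa using h1) hpos

/-- Every vector of `ℓ_p^2` is orthogonal to some nonzero vector. -/
theorem EllTwo.exists_orthogonal {u : EllTwo p} (hu : u ≠ 0) :
    ∃ w : EllTwo p, w ≠ 0 ∧ BJOrthogonal u w := by
  obtain ⟨ψ, hψ1, hψ⟩ := exists_dual_vector ℂ u (norm_ne_zero_iff.mpr hu)
  have hψz : ∀ z : EllTwo p,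
      ψ z = z 0 * ψ (EllTwo.mk p 1 0) + z 1 * ψ (EllTwo.mk p 0 1) := fun z => by
    rw [← smul_eq_mul, ← smul_eq_mul, ← map_smul, ← map_smul, ← map_add]
    congr 1
    apply EllTwo.ext <;> simp
  have hψ0 : ψ ≠ 0 := fun h => by simp [h] at hψ1
  -- A spanning vector of the kernel of `ψ`, which norms `u`.
  refine ⟨EllTwo.mk p (ψ (EllTwo.mk p 0 1)) (-ψ (EllTwo.mk p 1 0)), fun h => hψ0 ?_, fun c => ?_⟩
  · have h0 := congrArg (fun z : EllTwo p => z 0) h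
    have h1 := congrArg (fun z : EllTwo p => z 1) h
    simp only [EllTwo.mk_zero, EllTwo.mk_one, PiLp.zero_apply, neg_eq_zero] at h0 h1
    ext z
    rw [hψz z, h0, h1]
    simp
  · have hw : ψ (EllTwo.mk p (ψ (EllTwo.mk p 0 1)) (-ψ (EllTwo.mk p 1 0))) = 0 := by
      rw [hψz]; simp; ring
    have h1 := ψ.le_opNorm (u + c • EllTwo.mk p (ψ (EllTwo.mk p 0 1)) (-ψ (EllTwo.mk p 1 0)))
    rw [map_add, map_smul, hw, smul_zero, add_zero, hψ, hψ1, one_mul] at h1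
    simpa using h1

/-- The range of a left symmetric operator is a symmetric direction. -/
theorem EllTwo.exists_range {T : EllTwo p →L[ℂ] EllTwo p}
    (hT : IsLeftSymmetric T) {x y : EllTwo p} (hx : x ≠ 0) (hTx : ‖T x‖ = ‖T‖ * ‖x‖)
    (hu : T x ≠ 0) (hy : y ≠ 0) (hTy : T y = 0) :
    ∃ w : EllTwo p, w ≠ 0 ∧ BJOrthogonal (T x) w ∧ BJOrthogonal w (T x) := by
  obtain ⟨w, hw, huw⟩ := EllTwo.exists_orthogonal hu
  set k := EllTwo.area y with hk
  have hk0 : k ≠ 0 := EllTwo.area_ne_zero hy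
  -- Since `T y = 0`, `T` is the rank one operator `z ↦ (k z / k x) • T x`. Adding multiples of it
  -- to `k ⊗ w` only changes the vector factor.
  have hTk : ∀ z, k x • T z = k z • T x := fun z => by
    have e : k x • z = k z • x + (x 0 * z 1 - x 1 * z 0) • y := by
      apply EllTwo.ext
      · simp [hk, EllTwo.area_apply]; ring
      · simp [hk, EllTwo.area_apply]; ring
    rw [← map_smul, e, map_add, map_smul, map_smul, hTy, smul_zero, add_zero]
  have hkx : k x ≠ 0 := fun h => by
    apply hk0
    ext z
    have := hTk z
    rw [h, zero_smul, eq_comm] at this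
    exact (smul_eq_zero.mp this).resolve_right hu
  refine ⟨w, hw, huw, fun c => ?_⟩
  have hA : BJOrthogonal (ContinuousLinearMap.smulRight k w) T :=
    hT.of_norming hx hTx (huw.smul_right _)
  have h1 := hA (c * k x)
  have e : ContinuousLinearMap.smulRight k w + (c * k x) • T
      = ContinuousLinearMap.smulRight k (w + c • T x) := by
    refine ContinuousLinearMap.ext fun z => ?_
    simp only [add_apply, smul_apply,
      ContinuousLinearMap.smulRight_apply, mul_smul, hTk z, smul_add]
    rw [smul_comm c]
  rw [e, ContinuousLinearMap.norm_smulRight_apply, ContinuousLinearMap.norm_smulRight_apply] at h1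
  exact le_of_mul_le_mul_left h1 (norm_pos_iff.mpr hk0)

/-! ### Reduction to nonnegative real vectors -/

/-- The equality case of the triangle inequality, with one phase serving both numbers even when one
of them is zero. -/
theorem exists_phase {a b : ℝ} (ha : 0 < a) (hb : 0 < b) {z w : ℂ}
    (h : ‖(a : ℂ) * z + b * w‖ = a * ‖z‖ + b * ‖w‖) :
    ∃ θ : ℂ, ‖θ‖ = 1 ∧ z = θ * ‖z‖ ∧ w = θ * ‖w‖ := by
  rcases eq_or_ne z 0 with rfl | hz
  · rcases eq_or_ne w 0 with rfl | hw
    · exact ⟨1, by simp⟩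
    · have hw' : (‖w‖ : ℂ) ≠ 0 := by simpa using hw
      exact ⟨w / ‖w‖, by simp [hw], by simp, by field_simp⟩
  · have hz' : (‖z‖ : ℂ) ≠ 0 := by simpa using hz
    have na : ‖(a : ℂ) * z‖ = a * ‖z‖ := by
      rw [norm_mul, Complex.norm_real, Real.norm_of_nonneg ha.le]
    have nb : ‖(b : ℂ) * w‖ = b * ‖w‖ := by
      rw [norm_mul, Complex.norm_real, Real.norm_of_nonneg hb.le]
    have h1 := sameRay_iff_norm_add.mpr (h.trans (by rw [na, nb]))
    have h2 := sameRay_iff_norm_smul_eq.mp h1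
    rw [na, nb] at h2
    simp only [Complex.real_smul, Complex.ofReal_mul] at h2
    have haC : (a : ℂ) ≠ 0 := by exact_mod_cast ha.ne'
    have hbC : (b : ℂ) ≠ 0 := by exact_mod_cast hb.ne'
    refine ⟨z / ‖z‖, by simp [hz], by field_simp, ?_⟩
    field_simp
    refine mul_left_cancel₀ (mul_ne_zero haC hbC) ?_
    linear_combination h2

theorem EllTwo.norm_matrix_rpow (hp : 1 < p.toReal) {a b c d r s : ℝ} :
    ‖EllTwo.matrix p a b c d (EllTwo.mk p r s)‖ ^ p.toReal
      = |a * r + b * s| ^ p.toReal + |c * r + d * s| ^ p.toReal := by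
  rw [EllTwo.norm_rpow hp, EllTwo.matrix_apply]
  simp only [EllTwo.mk_zero, EllTwo.mk_one, ← Complex.ofReal_mul, ← Complex.ofReal_add,
    Complex.norm_real, Real.norm_eq_abs]

theorem EllTwo.norm_matrix_sub_rpow (hp : 1 < p.toReal) {a b c d a' b' c' d' r s t : ℝ} :
    ‖EllTwo.matrix p a b c d (EllTwo.mk p r s)
        - (t : ℂ) • EllTwo.matrix p a' b' c' d' (EllTwo.mk p r s)‖ ^ p.toReal
      = |a * r + b * s - t * (a' * r + b' * s)| ^ p.toReal
        + |c * r + d * s - t * (c' * r + d' * s)| ^ p.toReal := by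
  rw [EllTwo.norm_rpow hp, EllTwo.matrix_apply, EllTwo.matrix_apply]
  simp only [PiLp.sub_apply, PiLp.smul_apply, smul_eq_mul, EllTwo.mk_zero, EllTwo.mk_one,
    ← Complex.ofReal_mul, ← Complex.ofReal_add, ← Complex.ofReal_sub,
    Complex.norm_real, Real.norm_eq_abs]

theorem norm_add_le_of_nonneg {a b : ℝ} (ha : 0 ≤ a) (hb : 0 ≤ b) (z w : ℂ) :
    ‖(a : ℂ) * z + b * w‖ ≤ a * ‖z‖ + b * ‖w‖ := by
  refine (norm_add_le _ _).trans_eq ?_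
  rw [norm_mul, norm_mul, Complex.norm_real, Complex.norm_real, Real.norm_of_nonneg ha,
    Real.norm_of_nonneg hb]

/-- A matrix with nonnegative entries and a positive row that is orthogonal to a real matrix has a
nonnegative norming vector certifying this. -/
theorem EllTwo.exists_nonneg_norming (hp : 1 < p.toReal) {a b c d a' b' c' d' : ℝ}
    (ha : 0 ≤ a) (hb : 0 ≤ b) (hc : 0 ≤ c) (hd : 0 ≤ d) (hrow : 0 < a ∧ 0 < b ∨ 0 < c ∧ 0 < d)
    (h : BJOrthogonal (EllTwo.matrix p a b c d) (EllTwo.matrix p a' b' c' d')) :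
    ∃ r s : ℝ, 0 ≤ r ∧ 0 ≤ s ∧ r ^ p.toReal + s ^ p.toReal = 1 ∧
      (∀ x y : ℝ, 0 ≤ x → 0 ≤ y → (a * x + b * y) ^ p.toReal + (c * x + d * y) ^ p.toReal ≤
        ((a * r + b * s) ^ p.toReal + (c * r + d * s) ^ p.toReal)
          * (x ^ p.toReal + y ^ p.toReal)) ∧
      ∀ t : ℝ, 0 ≤ t → (a * r + b * s) ^ p.toReal + (c * r + d * s) ^ p.toReal ≤
        |a * r + b * s - t * (a' * r + b' * s)| ^ p.toReal
          + |c * r + d * s - t * (c' * r + d' * s)| ^ p.toReal := by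
  have hq0 : 0 < p.toReal := by linarith
  set A := EllTwo.matrix p a b c d with hA
  set T := EllTwo.matrix p a' b' c' d' with hT
  obtain ⟨v, hv1, hv2, hv3⟩ := h.exists_norming
  set r := ‖v 0‖ with hr
  set s := ‖v 1‖ with hs
  have hr0 : 0 ≤ r := norm_nonneg _
  have hs0 : 0 ≤ s := norm_nonneg _
  have hrs : r ^ p.toReal + s ^ p.toReal = 1 := by
    rw [hr, hs, ← EllTwo.norm_rpow hp, hv1, Real.one_rpow]
  have hnn : ∀ x y : ℝ, 0 ≤ x → 0 ≤ y →
      ‖EllTwo.mk p x y‖ ^ p.toReal = x ^ p.toReal + y ^ p.toReal := fun x y hx hy => by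
    rw [EllTwo.norm_rpow hp]
    simp [abs_of_nonneg hx, abs_of_nonneg hy]
  have hv'1 : ‖EllTwo.mk p r s‖ = 1 := by
    have := hnn r s hr0 hs0
    rw [hrs] at this
    exact (Real.rpow_left_inj (norm_nonneg _) zero_le_one hq0.ne').mp
      (this.trans (Real.one_rpow _).symm)
  have hle : ‖A (EllTwo.mk p r s)‖ ≤ ‖A v‖ := by
    rw [hv2]; simpa [hv'1] using A.le_opNorm (EllTwo.mk p r s)
  have hle' := Real.rpow_le_rpow (norm_nonneg _) hle hq0.le
  rw [hA, EllTwo.norm_matrix_rpow hp, abs_of_nonneg (by positivity), abs_of_nonneg (by positivity),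
    EllTwo.norm_rpow hp, EllTwo.matrix_apply, EllTwo.mk_zero, EllTwo.mk_one] at hle'
  have l1 := norm_add_le_of_nonneg ha hb (v 0) (v 1)
  have l2 := norm_add_le_of_nonneg hc hd (v 0) (v 1)
  have m1 := Real.rpow_le_rpow (norm_nonneg _) l1 hq0.le
  have m2 := Real.rpow_le_rpow (norm_nonneg _) l2 hq0.le
  -- Passing to moduli cannot decrease either row, and `v` is norming, so both rows are equalities;
  -- the positive row then forces a common phase.
  obtain ⟨θ, hθ, h0, h1⟩ : ∃ θ : ℂ, ‖θ‖ = 1 ∧ v 0 = θ * ‖v 0‖ ∧ v 1 = θ * ‖v 1‖ := by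
    rcases hrow with ⟨h1, h2⟩ | ⟨h1, h2⟩
    · exact exists_phase h1 h2 ((Real.rpow_left_inj (norm_nonneg _) (by positivity) hq0.ne').mp
        (le_antisymm m1 (by linarith)))
    · exact exists_phase h1 h2 ((Real.rpow_left_inj (norm_nonneg _) (by positivity) hq0.ne').mp
        (le_antisymm m2 (by linarith)))
  have hv : v = θ • EllTwo.mk p r s := by
    apply EllTwo.ext
    · simpa using h0
    · simpa using h1
  have hnorm : ‖A (EllTwo.mk p r s)‖ = ‖A‖ := by
    rw [← hv2, hv, map_smul, norm_smul, hθ, one_mul]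
  have hAq : ‖A‖ ^ p.toReal = (a * r + b * s) ^ p.toReal + (c * r + d * s) ^ p.toReal := by
    rw [← hnorm, hA, EllTwo.norm_matrix_rpow hp, abs_of_nonneg (by positivity),
      abs_of_nonneg (by positivity)]
  refine ⟨r, s, hr0, hs0, hrs, fun x y hx hy => ?_, fun t ht => ?_⟩
  · have h2 := Real.rpow_le_rpow (norm_nonneg _) (A.le_opNorm (EllTwo.mk p x y)) hq0.le
    rwa [Real.mul_rpow (norm_nonneg _) (norm_nonneg _), hAq, hnn x y hx hy, hA,
      EllTwo.norm_matrix_rpow hp, abs_of_nonneg (by positivity),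
      abs_of_nonneg (by positivity)] at h2
  · have h2 := hv3 t ht
    rw [hv, map_smul, map_smul, smul_comm, ← smul_sub, norm_smul, norm_smul, hθ, one_mul,
      one_mul, hnorm] at h2
    have h3 := Real.rpow_le_rpow (norm_nonneg _) h2 hq0.le
    rwa [hAq, hA, hT, EllTwo.norm_matrix_sub_rpow hp] at h3

/-! ### The four model pairs -/

theorem EllTwo.not_bjOrthogonal_axis_axis (hp : 1 < p.toReal) :
    ¬ BJOrthogonal (EllTwo.matrix p (0 : ℝ) (1 : ℝ) (1 : ℝ) (1 : ℝ))
      (EllTwo.matrix p (1 : ℝ) (0 : ℝ) (0 : ℝ) (0 : ℝ)) := fun h => by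
  obtain ⟨r, s, hr, hs, hrs, hmax, hdir⟩ := EllTwo.exists_nonneg_norming hp le_rfl zero_le_one
    zero_le_one zero_le_one (.inr ⟨one_pos, one_pos⟩) h
  set q := p.toReal
  have hq0 : 0 < q := by linarith
  have z0 : (0 : ℝ) ^ q = 0 := Real.zero_rpow hq0.ne'
  rcases hr.eq_or_lt with rfl | hr
  · have hs1 : s ^ q = 1 := by simpa [z0] using hrs
    -- Chosen so that `η ^ q = η / 2`; Bernoulli's inequality then shows that `(η, 1)` beats `(0,
    -- 1)`.
    set η : ℝ := (1 / 2) ^ (q - 1)⁻¹ with hη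
    have hη0 : 0 < η := by positivity
    have hηq : η ^ q = η / 2 := by
      have e : η ^ (q - 1) = 1 / 2 := by
        rw [hη, ← Real.rpow_mul (by norm_num), inv_mul_cancel₀ (by linarith), Real.rpow_one]
      have e2 := Real.rpow_add_one hη0.ne' (q - 1)
      rw [sub_add_cancel, e] at e2
      linarith
    have h1 := hmax η 1 hη0.le zero_le_one
    have h2 := one_add_mul_self_lt_rpow_one_add (s := η) (by linarith) hη0.ne' hp
    simp [hs1, hηq, add_comm η 1] at h1
    nlinarith
  rcases hs.eq_or_lt with rfl | hs
  · have hr1 : r ^ q = 1 := by simpa [z0] using hrs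
    have h1 := hmax 0 1 le_rfl zero_le_one
    simp [hr1, z0] at h1
    linarith
  -- This step annihilates the first coordinate of the image and leaves the second unchanged.
  have h1 := hdir (s / r) (by positivity)
  have e : s / r * r = s := by field_simp
  simp [e, z0, abs_of_pos (add_pos hr hs)] at h1
  have := Real.rpow_pos_of_pos hs q
  linarith

/-- The left side of `h` is the value at `(1, 0)`. If `r ≤ s`, convexity bounds each term on the
right by `2 ^ q / 2`, which is too small. -/
theorem lt_of_norming {q r s : ℝ} (hq : 1 < q) (hr : 0 ≤ r) (hs : 0 ≤ s) (hrs : r ^ q + s ^ q = 1)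
    (h : 1 + 2 ^ q ≤ (r + s) ^ q + (2 * r) ^ q) : s < r := by
  by_contra! hle
  have hq0 : 0 < q := by linarith
  have h1 := midpoint_rpow_le hq hr hs
  have h2 : r ^ q ≤ s ^ q := Real.rpow_le_rpow hr hle hq0.le
  rw [Real.mul_rpow two_pos.le hr, show r + s = 2 * ((r + s) / 2) by ring,
    Real.mul_rpow two_pos.le (by positivity)] at h
  have h3 : (0 : ℝ) < 2 ^ q := by positivity
  nlinarith

theorem EllTwo.not_bjOrthogonal_diag_axis (hp : 1 < p.toReal) :
    ¬ BJOrthogonal (EllTwo.matrix p (1 : ℝ) (1 : ℝ) (2 : ℝ) (0 : ℝ))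
      (EllTwo.matrix p (1 : ℝ) (-1 : ℝ) (0 : ℝ) (0 : ℝ)) := fun h => by
  obtain ⟨r, s, hr, hs, hrs, hmax, hdir⟩ := EllTwo.exists_nonneg_norming hp zero_le_one zero_le_one
    two_pos.le le_rfl (.inl ⟨one_pos, one_pos⟩) h
  set q := p.toReal
  have hq0 : 0 < q := by linarith
  have z0 : (0 : ℝ) ^ q = 0 := Real.zero_rpow hq0.ne'
  have hlt : s < r := lt_of_norming hp hr hs hrs (by simpa [z0] using hmax 1 0 zero_le_one le_rfl)
  have hpos : 0 < r - s := by linarith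
  -- Again the first coordinate of the image is annihilated.
  have h1 := hdir ((r + s) / (r - s)) (by positivity)
  have e : (r + s) / (r - s) * (r + -s) = r + s := by rw [← sub_eq_add_neg]; field_simp
  simp [e, z0, abs_of_nonneg hr] at h1
  have : 0 < (r + s) ^ q := Real.rpow_pos_of_pos (by linarith) q
  linarith

theorem EllTwo.not_bjOrthogonal_diag_diag (hp : 1 < p.toReal) :
    ¬ BJOrthogonal (EllTwo.matrix p (2 : ℝ) (0 : ℝ) (1 : ℝ) (1 : ℝ))
      (EllTwo.matrix p (1 : ℝ) (1 : ℝ) (-1 : ℝ) (-1 : ℝ)) := fun h => by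
  obtain ⟨r, s, hr, hs, hrs, hmax, hdir⟩ := EllTwo.exists_nonneg_norming hp two_pos.le le_rfl
    zero_le_one zero_le_one (.inr ⟨one_pos, one_pos⟩) h
  set q := p.toReal
  have hq0 : 0 < q := by linarith
  have z0 : (0 : ℝ) ^ q = 0 := Real.zero_rpow hq0.ne'
  have hlt : s < r := lt_of_norming hp hr hs hrs
    (by simpa [z0, add_comm] using hmax 1 0 zero_le_one le_rfl)
  have hpos : 0 < r + s := by linarith
  have hpos' : 0 < r - s := by linarith
  -- This step replaces the unequal coordinates `2 * r` and `r + s` by their mean, which strictly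
  -- lowers the norm.
  have h1 := hdir ((r - s) / (2 * (r + s))) (by positivity)
  have e1 : 2 * r + 0 * s - (r - s) / (2 * (r + s)) * (1 * r + 1 * s) = (2 * r + (r + s)) / 2 := by
    field_simp; ring
  have e2 : 1 * r + 1 * s - (r - s) / (2 * (r + s)) * (-1 * r + -1 * s)
      = (2 * r + (r + s)) / 2 := by
    field_simp; ring
  rw [e1, e2, abs_of_pos (by positivity), ← two_mul] at h1
  have h2 := midpoint_rpow_lt (q := q) (a := 2 * r) (b := r + s) hp (by positivity) (by positivity)
    (by linarith)
  simp at h1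
  linarith

theorem EllTwo.not_bjOrthogonal_axis_diag (hp : 1 < p.toReal) :
    ¬ BJOrthogonal (EllTwo.matrix p (1 : ℝ) (2 : ℝ) (1 : ℝ) (0 : ℝ))
      (EllTwo.matrix p (1 : ℝ) (0 : ℝ) (-1 : ℝ) (0 : ℝ)) := fun h => by
  obtain ⟨r, s, hr, hs, hrs, hmax, hdir⟩ := EllTwo.exists_nonneg_norming hp zero_le_one two_pos.le
    zero_le_one le_rfl (.inl ⟨one_pos, two_pos⟩) h
  set q := p.toReal
  have hq0 : 0 < q := by linarith
  have z0 : (0 : ℝ) ^ q = 0 := Real.zero_rpow hq0.ne'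
  rcases hr.eq_or_lt with rfl | hr
  · have hs1 : s ^ q = 1 := by simpa [z0] using hrs
    -- `(1, 1)` beats `(0, 1)` because `3 ^ q + 1 > 2 * 2 ^ q`.
    have h1 := hmax 1 1 zero_le_one zero_le_one
    have h2 := midpoint_rpow_lt (q := q) (a := 3) (b := 1) hp (by norm_num) (by norm_num)
      (by norm_num)
    simp [z0, Real.mul_rpow two_pos.le hs, hs1] at h1
    norm_num at h1 h2
    linarith
  rcases hs.eq_or_lt with rfl | hs
  · have hr1 : r ^ q = 1 := by simpa [z0] using hrs
    have h1 := hmax 0 1 le_rfl zero_le_one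
    have h2 := midpoint_rpow_lt (q := q) (a := 2) (b := 0) hp (by norm_num) (by norm_num)
      (by norm_num)
    simp [z0, hr1] at h1 h2
    linarith
  -- Both coordinates of the image move to their mean `r + s`.
  have h1 := hdir (s / r) (by positivity)
  have e1 : 1 * r + 2 * s - s / r * (1 * r + 0 * s) = ((r + 2 * s) + r) / 2 := by
    field_simp; ring
  have e2 : 1 * r + 0 * s - s / r * (-1 * r + 0 * s) = ((r + 2 * s) + r) / 2 := by
    field_simp; ring
  rw [e1, e2, abs_of_pos (by positivity), ← two_mul] at h1
  have h2 := midpoint_rpow_lt (q := q) (a := r + 2 * s) (b := r) hp (by positivity) hr.le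
    (by linarith)
  simp at h1
  linarith

/-! ### Transport to the models and conclusion -/

/-- Transport of left symmetry of a rank one operator to a model operator `M`. -/
theorem IsLeftSymmetric.bjOrthogonal_of_mapsLines {T : EllTwo p →L[ℂ] EllTwo p}
    (hT : IsLeftSymmetric T) {x y w : EllTwo p} (hx : x ≠ 0) (hTx : ‖T x‖ = ‖T‖ * ‖x‖)
    (hTy : T y = 0) (hw : BJOrthogonal (T x) w) {e e' f f' : EllTwo p}
    {V U : EllTwo p ≃ₗᵢ[ℂ] EllTwo p} (hV : MapsLines V e e' x y) (hU : MapsLines U f f' (T x) w)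
    (hspan : ∀ z, ∃ s t : ℂ, z = s • e + t • e') {A M : EllTwo p →L[ℂ] EllTwo p} {k μ : ℂ}
    (hA : A e = k • f') (hM : M e = μ • f) (hM' : M e' = 0) : BJOrthogonal A M := by
  obtain ⟨⟨a, ha, hxa⟩, b, hb⟩ := hV
  obtain ⟨⟨a', ha', hua⟩, b', hb'⟩ := hU
  let conj : (EllTwo p →L[ℂ] EllTwo p) → (EllTwo p →L[ℂ] EllTwo p) := fun B =>
    U.toLinearIsometry.toContinuousLinearMap.comp
      (B.comp (V.symm : EllTwo p →L[ℂ] EllTwo p))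
  have hconj : ∀ B z, conj B z = U (B (V.symm z)) := fun B z => rfl
  have hnorm : ∀ B, ‖conj B‖ = ‖B‖ := fun B =>
    (LinearIsometry.norm_toContinuousLinearMap_comp _).trans
      (ContinuousLinearMap.opNorm_comp_linearIsometryEquiv B V.symm)
  have hTe : T (V e) = a⁻¹ • T x := by
    conv_rhs => rw [hxa]
    rw [map_smul, inv_smul_smul₀ ha]
  have hUf : U f = a'⁻¹ • T x := by rw [hua, inv_smul_smul₀ ha']
  -- Both sides kill `V e'` and agree on `V e`, and these two vectors span.
  have hMT : conj M = (μ * a'⁻¹ * a) • T := by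
    refine ContinuousLinearMap.ext fun z => ?_
    obtain ⟨s, t, hz⟩ := hspan (V.symm z)
    have hz' : z = s • V e + t • V e' := by
      rw [← map_smul, ← map_smul, ← map_add, ← hz, V.apply_symm_apply]
    rw [hconj, hz, smul_apply]
    conv_rhs => rw [hz']
    simp only [map_add, map_smul, hM, hM', hb, hTy, hTe, hUf, smul_zero, add_zero, smul_smul]
    congr 1
    field_simp
  have hAx : BJOrthogonal (conj A) T := by
    refine hT.of_norming hx hTx ?_
    have e1 : conj A x = (a * k * b') • w := by
      rw [hconj, hxa, map_smul, V.symm_apply_apply, map_smul, hA, map_smul, map_smul, hb',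
        smul_smul, smul_smul, mul_assoc]
    rw [e1]
    exact hw.smul_right _
  intro c
  have h1 := hAx.smul_right (μ * a'⁻¹ * a) c
  have h2 : conj A + c • conj M = conj (A + c • M) :=
    ContinuousLinearMap.ext fun z => by simp [hconj]
  rwa [← hMT, h2, hnorm, hnorm] at h1

theorem IsLeftSymmetric.eq_zero (hp : 1 < p.toReal) {T : EllTwo p →L[ℂ] EllTwo p}
    (hT : IsLeftSymmetric T) : T = 0 := by
  by_contra hT0
  obtain ⟨x, hx1, hTx⟩ := exists_norm_one_norm_apply_eq T
  have hx : x ≠ 0 := fun h => by simp [h] at hx1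
  have hTx' : ‖T x‖ = ‖T‖ * ‖x‖ := by rw [hTx, hx1, mul_one]
  have hu : T x ≠ 0 := norm_pos_iff.mp (hTx ▸ norm_pos_iff.mpr hT0)
  obtain ⟨y, hy, hTy, hxy, hyx⟩ := EllTwo.exists_kernel hp hT0 hT hx hTx'
  obtain ⟨w, hw, huw, hwu⟩ := EllTwo.exists_range hT hx hTx' hu hy hTy
  rcases EllTwo.exists_mapsLines hp hx hy hxy hyx with ⟨V, hV⟩ | hV <;>
    rcases EllTwo.exists_mapsLines hp hu hw huw hwu with ⟨U, hU⟩ | hU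
  · exact EllTwo.not_bjOrthogonal_axis_axis hp
      (hT.bjOrthogonal_of_mapsLines hx hTx' hTy huw hV hU EllTwo.span_axes (k := 1) (μ := 1)
        (EllTwo.ext (by simp) (by simp)) (EllTwo.ext (by simp) (by simp))
        (EllTwo.ext (by simp) (by simp)))
  -- The signs of the diagonals here and below are those matching the nonnegative model matrices;
  -- here `f' = (1, 1)`.
  · obtain ⟨U, hU⟩ := hU (-1) (.inr rfl)
    exact EllTwo.not_bjOrthogonal_axis_diag hp
      (hT.bjOrthogonal_of_mapsLines hx hTx' hTy huw hV hU EllTwo.span_axes (k := 1) (μ := 1)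
        (EllTwo.ext (by simp) (by simp)) (EllTwo.ext (by simp) (by simp))
        (EllTwo.ext (by simp) (by simp)))
  · obtain ⟨V, hV⟩ := hV (-1) (.inr rfl)
    exact EllTwo.not_bjOrthogonal_diag_axis hp
      (hT.bjOrthogonal_of_mapsLines hx hTx' hTy huw hV hU (EllTwo.span_diagonals (by norm_num))
        (k := 2) (μ := 2) (EllTwo.ext (by simp) (by simp))
        (EllTwo.ext (by norm_num) (by simp)) (EllTwo.ext (by simp) (by simp)))
  · obtain ⟨V, hV⟩ := hV 1 (.inl rfl)
    obtain ⟨U, hU⟩ := hU (-1) (.inr rfl)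
    exact EllTwo.not_bjOrthogonal_diag_diag hp
      (hT.bjOrthogonal_of_mapsLines hx hTx' hTy huw hV hU (EllTwo.span_diagonals (by norm_num))
        (k := 2) (μ := 2) (EllTwo.ext (by simp) (by norm_num))
        (EllTwo.ext (by norm_num) (by norm_num)) (EllTwo.ext (by simp) (by simp)))

end EllTwo

theorem mainTheorem6 (p : ℝ≥0∞) [Fact (1 ≤ p)] (hp_one : 1 < p) (hp_top : p < ∞)
    (T : EllTwo p →L[ℂ] EllTwo p) :
    IsLeftSymmetric T ↔ T = 0 := by
  refine ⟨fun hT => hT.eq_zero (one_lt_toReal hp_one hp_top), ?_⟩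
  rintro rfl y -
  exact BJOrthogonal.zero_right y
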